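/- Let $n\ge 1$, $d\ge 0$, let $f_1,\dots,f_n:\mathbb{R}^d\to\mathbb{R}$ be convex and $G$-Lipschitz with respect to the Euclidean norm ($G>0$; the $f_i$ need not be differentiable), let $g:\mathbb{R}^d\to\mathbb{R}$ be $\mu$-strongly convex ($\mu>0$), and put $F(x)=\frac1n\sum_{i=1}^n f_i(x)+g(x)$. Let $x^\star$ be a minimizer of $F$, let $x_0\in\mathbb{R}^d$ be a starting point, let $\varepsilon>0$, and let $\Delta\ge F(x_0)-F(x^\star)$ (for instance $\Delta=F(x_0)-F(x^\star)$). For $\delta>0$ let $f_i^{\delta}(x)=\inf_{y}\{f_i(y)+\frac{\delta}{2}\|x-y\|^2\}$ be the Moreau envelope of $f_i$. **ASVRG.** For differentiable $h_1,\dots,h_n$, one *epoch* with momentum $\omega$, step size $\eta$ and length $m$, from a snapshot $\widetilde x$ and points $x_0,y_0$, is: compute $\widetilde\nabla=\frac1n\sum_i\nabla h_i(\widetilde x)$; for $t=1,\dots,m$ draw $i_t$ uniformly from $\{1,\dots,n\}$, independently of the past, and set $$v_t=\nabla h_{i_t}(x_{t-1})-\nabla h_{i_t}(\widetilde x)+\widetilde\nabla,\qquad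 y_t=\arg\min_y\Big\{\langle v_t,y-y_{t-1}\rangle+\frac{\omega}{2\eta}\|y-y_{t-1}\|^2+g(y)\Big\},\qquad x_t=\widetilde x+\omega(y_t-\widetilde x).$$ The new snapshot is $\widetilde x^{+}=\frac1m\sum_{t=1}^m x_t$, and the next epoch starts from the points $(1-\omega)\widetilde x^{+}+\omega y_m$ and $y_m$. A *round* from a point $z$ consists of $S$ consecutive epochs, the first one with $\widetilde x=x_0=y_0=z$, and returns the average of the $S$ new snapshots. With input $(h_i),g,\mu,L$, where the $h_i$ are $L$-smooth, ASVRG runs two rounds, the second one restarted from the output of the first, with $m=n$, $$\eta=\frac1{3L},\ \ \omega=\sqrt{\frac{n\mu}{3L}}\ \ \text{ if } \frac{n\mu}{L}\le\frac34,\qquad\quad \eta=\frac1{4n\mu},\ \ \omega=\frac12\ \ \text{ otherwise},\qquad\quad S=\Big\lceil 2\Big(\frac{1-\omega}{\omega}+\frac{\omega}{\eta n\mu}\Big)\Big\rceil .$$ **Adaptive smoothing.** Put $T=\max\{0,\lceil\log_2(4\Delta/\varepsilon)\rceil\}$ (and $T=0$ if $\Delta=0$) and $\delta_s=2^s G^2/\Delta$.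 For $s=0,\dots,T-1$, run ASVRG on the smoothed problem $F^{\delta_s}=\frac1n\sum_i f_i^{\delta_s}+g$ with $L=\delta_s$, starting from the output of the previous stage (from $x_0$ if $s=0$). Let $\widehat x$ be the output of the last stage ($\widehat x=x_0$ if $T=0$). Then $\mathbb{E}[F(\widehat x)]-F(x^\star)\le\varepsilon$, where the expectation exists, and on every run the total number of component gradient evaluations (evaluations of some $\nabla f_i^{\delta_s}$; each epoch uses $n$ of them for the full gradient and two per inner iteration) is at most $$C\left(n\,\max\Big\{1,\log\frac{\Delta}{\varepsilon}\Big\}+\frac{\sqrt n\,G}{\sqrt{\mu\varepsilon}}\right)$$ (with the logarithm term read as $1$ if $\Delta=0$), where $C$ is an absolute constant. With $\Delta=F(x_0)-F(x^\star)$ this is the oracle complexity $O\big(n\log\frac{F(x_0)-F(x^\star)}{\varepsilon}+\frac{\sqrt n\,G}{\sqrt{\mu\varepsilon}}\big)$. -/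

import Mathlib

noncomputable section

/-- Euclidean space `ℝ^d`. -/
abbrev Vec (d : ℕ) : Type := EuclideanSpace ℝ (Fin d)

/-- The composite objective `F(x) = (1/n) ∑ᵢ fᵢ(x) + g(x)`. -/
def objective {d n : ℕ} (f : Fin n → Vec d → ℝ) (g : Vec d → ℝ) (x : Vec d) : ℝ :=
  (1 / (n : ℝ)) * ∑ i, f i x + g x

/-- The `δ`-Moreau envelope `f^δ(x) = inf_y { f(y) + (δ/2) ‖x - y‖² }`. -/
def moreauEnvelope {d : ℕ} (δ : ℝ) (f : Vec d → ℝ) (x : Vec d) : ℝ :=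
  ⨅ y : Vec d, (f y + δ / 2 * ‖x - y‖ ^ 2)

/-- A global minimizer of `h` (an arbitrary point if there is none). -/
def argMin {d : ℕ} (h : Vec d → ℝ) : Vec d :=
  Classical.epsilon fun y => ∀ z, h y ≤ h z

/-- The expectation of `h` under a discrete distribution `p`. -/
def expect {α : Type} (p : PMF α) (h : α → ℝ) : ℝ :=
  ∑' a, (p a).toReal * h a

/-- The randomized loop `for k = 0, …, N - 1 do z ← step k z`. -/
def forLoop {σ : Type} (step : ℕ → σ → PMF σ) : ℕ → σ → PMF σ
  | 0, z => PMF.pure z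
  | N + 1, z => (forLoop step N z).bind (step N)

/-- Parameters of ASVRG: maximal epoch length `m`, first epoch length `m₁`, epoch growth factor `ρ`,
step size `η`, momentum `ω`, sampling distribution `p`, number of epochs `S` between two restarts,
and number `R` of rounds of `S` epochs. -/
structure ASVRGParams (n : ℕ) where
  m : ℕ
  m₁ : ℕ
  ρ : ℝ
  η : ℝ
  ω : ℝ
  p : PMF (Fin n)
  S : ℕ
  R : ℕ

/-- Epoch lengths: `m₁` for the first epoch, then `m_{s+1} = min(⌊ρ m_s⌋, m)`
(`epochLength s` is the length of epoch number `s + 1`). -/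
def ASVRGParams.epochLength {n : ℕ} (P : ASVRGParams n) : ℕ → ℕ
  | 0 => P.m₁
  | s + 1 => min ⌊P.ρ * (P.epochLength s : ℝ)⌋₊ P.m

/-- State of the inner loop: the iterates `x_t`, `y_t`, the running sum `x_1 + ⋯ + x_t`, and the
number of component gradient evaluations made so far. -/
structure InnerState (d : ℕ) where
  x : Vec d
  y : Vec d
  sum : Vec d
  calls : ℕ

/-- State between two epochs: the snapshot `x̃^s`, the initial points `x^{s+1}_0`, `y^{s+1}_0` of the
next epoch, the running sum `x̃^1 + ⋯ + x̃^s`, and the number of component gradient evaluations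
made so far. -/
structure EpochState (d : ℕ) where
  snap : Vec d
  x : Vec d
  y : Vec d
  sum : Vec d
  calls : ℕ

/-- The variance reduced estimator `[∇fᵢ(x) - ∇fᵢ(x̃)] / (n pᵢ) + ∇f(x̃)`; `full` is the
stored full gradient `∇f(x̃)`. -/
def svrgEstimator {d n : ℕ} (f : Fin n → Vec d → ℝ) (p : PMF (Fin n)) (snap full x : Vec d)
    (i : Fin n) : Vec d :=
  (1 / ((n : ℝ) * (p i).toReal)) • (gradient (f i) x - gradient (f i) snap) + full

/-- `argmin_y { ⟨v, y - y₀⟩ + ω/(2η) ‖y - y₀‖² + g(y) }`. -/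
def proxStep {d : ℕ} (g : Vec d → ℝ) (ω η : ℝ) (v y₀ : Vec d) : Vec d :=
  argMin fun y => inner ℝ v (y - y₀) + ω / (2 * η) * ‖y - y₀‖ ^ 2 + g y

/-- One inner iteration of ASVRG once the index `i` has been drawn: it evaluates the two component
gradients `∇fᵢ(x_{t-1})` and `∇fᵢ(x̃)`. -/
def innerUpdate {d n : ℕ} (f : Fin n → Vec d → ℝ) (g : Vec d → ℝ) (P : ASVRGParams n)
    (snap full : Vec d) (z : InnerState d) (i : Fin n) : InnerState d :=
  let y' := proxStep g P.ω P.η (svrgEstimator f P.p snap full z.x i) z.y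
  let x' := snap + P.ω • (y' - snap)
  { x := x', y := y', sum := z.sum + x', calls := z.calls + 2 }

/-- One inner iteration of ASVRG, with the index drawn from `P.p`. -/
def innerStep {d n : ℕ} (f : Fin n → Vec d → ℝ) (g : Vec d → ℝ) (P : ASVRGParams n)
    (snap full : Vec d) (z : InnerState d) : PMF (InnerState d) :=
  P.p.bind fun i => PMF.pure (innerUpdate f g P snap full z i)

/-- End of an epoch of length `m`: the new snapshot is the average of `x_1, …, x_m`, and the next
epoch starts from `x_0 = (1 - ω) x̃ + ω y_m` and `y_0 = y_m`. -/
def epochEnd {d : ℕ} (ω : ℝ) (m : ℕ) (z : EpochState d) (w : InnerState d) : EpochState d :=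
  let snap' := (1 / (m : ℝ)) • w.sum
  { snap := snap'
    x := (1 - ω) • snap' + ω • w.y
    y := w.y
    sum := z.sum + snap'
    calls := w.calls }

/-- Epoch number `s + 1` of ASVRG: the full gradient at the snapshot is computed with `n` component
gradient evaluations, and then the inner loop is run. -/
def epoch {d n : ℕ} (f : Fin n → Vec d → ℝ) (g : Vec d → ℝ) (P : ASVRGParams n)
    (s : ℕ) (z : EpochState d) : PMF (EpochState d) :=
  let full := (1 / (n : ℝ)) • ∑ i, gradient (f i) z.snap
  (forLoop (fun _ => innerStep f g P z.snap full) (P.epochLength s)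
      { x := z.x, y := z.y, sum := 0, calls := z.calls + n }).bind
    fun w => PMF.pure (epochEnd P.ω (P.epochLength s) z w)

/-- One round of ASVRG: `S` epochs from `x̃^0 = x_0 = y_0`, returning the uniform average
`(x̃^1 + ⋯ + x̃^S) / S` of the snapshots, which is the starting point after a restart. The second
component is the number of component gradient evaluations made so far. -/
def asvrgRound {d n : ℕ} (f : Fin n → Vec d → ℝ) (g : Vec d → ℝ) (P : ASVRGParams n)
    (z : Vec d × ℕ) : PMF (Vec d × ℕ) :=
  (forLoop (epoch f g P) P.S
      { snap := z.1, x := z.1, y := z.1, sum := 0, calls := z.2 }).bind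
    fun w => PMF.pure ((1 / (P.S : ℝ)) • w.sum, w.calls)

/-- ASVRG (with `x_0^{s+1} = (1-ω) x̃^s + ω y^s_m`, `y_0^{s+1} = y^s_m`) with a restart
every `S` epochs, `R` rounds in all. -/
def asvrg {d n : ℕ} (f : Fin n → Vec d → ℝ) (g : Vec d → ℝ) (P : ASVRGParams n)
    (z : Vec d × ℕ) : PMF (Vec d × ℕ) :=
  forLoop (fun _ => asvrgRound f g P) P.R z

/-- The parameter choice for `L`-smooth components and `μ`-strongly convex `g`: uniform sampling,
`m_s = n` for all epochs, `η = 1/(3L)`, `ω = √(nμ/(3L))` if `nμ/L ≤ 3/4`, and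
`η = 1/(4nμ)`, `ω = 1/2` otherwise; restarts every `S = ⌈2((1-ω)/ω + ω/(ηnμ))⌉` epochs; two
rounds. -/
def smoothParams (n : ℕ) [NeZero n] (μ L : ℝ) : ASVRGParams n :=
  let η : ℝ := if n * μ / L ≤ 3 / 4 then 1 / (3 * L) else 1 / (4 * n * μ)
  let ω : ℝ := if n * μ / L ≤ 3 / 4 then √(n * μ / (3 * L)) else 1 / 2
  { m := n
    m₁ := n
    ρ := 1
    η := η
    ω := ω
    p := PMF.uniformOfFintype (Fin n)
    S := ⌈2 * ((1 - ω) / ω + ω / (η * n * μ))⌉₊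
    R := 2 }

/-- The adaptive smoothing reduction applied to ASVRG: in stage `s = 0, …, T - 1`, ASVRG is run,
from the output of the previous stage, on the smoothed problem
`F^{δ_s} = (1/n) ∑ᵢ fᵢ^{δ_s} + g` with `δ_s = 2^s δ₀`. The result is the distribution of the
output point together with the total number of component gradient evaluations. -/
def adaptSmoothASVRG {d n : ℕ} [NeZero n] (f : Fin n → Vec d → ℝ) (g : Vec d → ℝ)
    (μ δ₀ : ℝ) (T : ℕ) (x₀ : Vec d) : PMF (Vec d × ℕ) :=
  forLoop
    (fun s => asvrg (fun i => moreauEnvelope (2 ^ s * δ₀) (f i)) g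
      (smoothParams n μ (2 ^ s * δ₀)))
    T (x₀, 0)

end

/-! The Moreau envelope of a convex `G`-Lipschitz function is convex and `δ`-smooth, and lies below
the function by at most `G²/(2δ)` (`isSmoothConvex_moreauEnvelope`, `moreauEnvelope_le`,
`le_moreauEnvelope_add`). Two rounds of ASVRG divide the expected gap of a smoothed problem by four
(`asvrg_bound`). For the gap `a_s` of the original `F` after `s` stages, this gives `4 E a_{s+1} ≤ E
a_s + (5/2) G²/δ_s`. Since `δ_s = 2^s G²/Δ`, the expected gap decays like `Δ/2^T`. A stage costs
`O(n + √(n δ_s/μ))`; the first terms add up to `O(nT)`, the second to a geometric sum of ratio `√2`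
dominated by its last term.

ASVRG itself rests on `innerUpdate_progress`: the cocoercivity of the component gradients bounds the
variance of the estimator by a Bregman divergence between snapshot and iterate, and the momentum
step leaves exactly this much slack. Averaging over an epoch and telescoping over epochs leave the
initial gap and the initial squared distance; strong convexity bounds the latter by the former, and
`S` is chosen so that a round halves the gap. All randomness is finite, so each level is one
application of `forLoop_supermartingale` with a suitable potential. -/

section StronglyConvex

open Filter Topology

/-! ### Strong convexity: quadratic growth and existence of minimizers. -/

/-- A strongly convex function grows quadratically around a minimizer. -/
theorem StrongConvexOn.add_sq_le_of_forall_le {E : Type*} [NormedAddCommGroup E]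
    [NormedSpace ℝ E] {m : ℝ} {h : E → ℝ} (hh : StrongConvexOn Set.univ m h) {p : E}
    (hp : ∀ z, h p ≤ h z) (y : E) : h p + m / 2 * ‖y - p‖ ^ 2 ≤ h y := by
  -- Compare `p` with the point `t • y + (1 - t) • p`, divide by `t`, and let `t` tend to `0`.
  have key : ∀ t ∈ Set.Ioo (0 : ℝ) 1, (1 - t) * (m / 2 * ‖y - p‖ ^ 2) ≤ h y - h p := by
    intro t ht
    have h1 := hh.2 (Set.mem_univ y) (Set.mem_univ p) ht.1.le (sub_nonneg.2 ht.2.le)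
      (by ring)
    have h2 := hp (t • y + (1 - t) • p)
    simp only [smul_eq_mul] at h1
    refine le_of_mul_le_mul_left ?_ ht.1
    linarith
  have hlim : Tendsto (fun t : ℝ => (1 - t) * (m / 2 * ‖y - p‖ ^ 2)) (𝓝[>] 0)
      (𝓝 ((1 - 0) * (m / 2 * ‖y - p‖ ^ 2))) :=
    ((by fun_prop : Continuous fun t : ℝ => (1 - t) * (m / 2 * ‖y - p‖ ^ 2)).tendsto 0).mono_left
      nhdsWithin_le_nhds
  have := le_of_tendsto hlim
    (eventually_of_mem (Ioo_mem_nhdsGT (zero_lt_one' ℝ)) key)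
  linarith

/-- A strongly convex function on a finite-dimensional space has a minimizer. -/
theorem StrongConvexOn.exists_forall_le {E : Type*} [NormedAddCommGroup E]
    [NormedSpace ℝ E] [FiniteDimensional ℝ E] {m : ℝ} (hm : 0 < m) {h : E → ℝ}
    (hh : StrongConvexOn Set.univ m h) : ∃ p, ∀ z, h p ≤ h z := by
  have hcont : Continuous h := by
    have := (hh.convexOn (fun r => by positivity)).continuousOn isOpen_univ
    rwa [continuousOn_univ] at this
  have := FiniteDimensional.proper_real E
  obtain ⟨b, hb⟩ : ∃ b, ∀ x ∈ Metric.closedBall (0 : E) 1, b ≤ h x := by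
    obtain ⟨b, hb⟩ := ((isCompact_closedBall (0 : E) 1).image hcont).bddBelow
    exact ⟨b, fun x hx => hb ⟨x, hx, rfl⟩⟩
  -- Outside the ball of radius `R`, the strong convexity inequality on the segment from `0` to `x`,
  -- taken at its point of norm one, gives `h x ≥ h 0 + ‖x‖ (b - h 0) + (‖x‖ - 1) (m / 2) ‖x‖`. This
  -- `R` makes the last term win.
  obtain ⟨R, hR1, hR⟩ : ∃ R : ℝ, 1 ≤ R ∧ |b - h 0| * 2 ≤ (R - 1) * m := by
    refine ⟨1 + |b - h 0| * 2 / m, by simp; positivity, ?_⟩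
    rw [add_sub_cancel_left, div_mul_cancel₀ _ hm.ne']
  refine hcont.exists_forall_le' 0 ?_
  rw [← Metric.cobounded_eq_cocompact]
  filter_upwards [(hasBasis_cobounded_norm (E := E)).mem_of_mem (i := R) trivial] with x hx
  have hx : R ≤ ‖x‖ := hx
  have hpos : 0 < ‖x‖ := by linarith
  have h1 := hh.2 (Set.mem_univ x) (Set.mem_univ 0) (inv_nonneg.2 hpos.le)
      (sub_nonneg.2 (inv_le_one_of_one_le₀ (hR1.trans hx))) (by ring)
  simp only [smul_eq_mul, smul_zero, add_zero, sub_zero] at h1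
  have h2 := hb (‖x‖⁻¹ • x) (by simp [norm_smul, hpos.ne'])
  have h3 := mul_le_mul_of_nonneg_left (h2.trans h1) hpos.le
  have h4 : ‖x‖ * (‖x‖⁻¹ * h x + (1 - ‖x‖⁻¹) * h 0 - ‖x‖⁻¹ * (1 - ‖x‖⁻¹) * (m / 2 * ‖x‖ ^ 2))
      = h x + (‖x‖ - 1) * h 0 - (‖x‖ - 1) * m / 2 * ‖x‖ := by
    field_simp
  rw [h4] at h3
  have h5 : |b - h 0| * 2 ≤ (‖x‖ - 1) * m := hR.trans (by gcongr)
  have h6 := neg_abs_le (b - h 0)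
  nlinarith

theorem strongConvexOn_sq_norm_sub {E : Type*} [NormedAddCommGroup E] [InnerProductSpace ℝ E]
    (c : ℝ) (x : E) : StrongConvexOn Set.univ c fun y => c / 2 * ‖y - x‖ ^ 2 := by
  refine ⟨convex_univ, fun y _ z _ a b _ _ hab => le_of_eq ?_⟩
  have h1 : a • y + b • z - x = a • (y - x) + b • (z - x) := by
    rw [smul_sub, smul_sub, sub_add_sub_comm, ← add_smul, hab, one_smul]
  have h2 : y - z = (y - x) - (z - x) := by abel
  obtain rfl : b = 1 - a := by linarith
  simp only [h1, h2, smul_eq_mul]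
  generalize y - x = u, z - x = v
  rw [norm_add_sq_real, norm_sub_sq_real, norm_smul, norm_smul, real_inner_smul_left,
    real_inner_smul_right, mul_pow, mul_pow, Real.norm_eq_abs, Real.norm_eq_abs, sq_abs, sq_abs]
  ring

theorem ConvexOn.add_strongConvexOn {E : Type*} [NormedAddCommGroup E] [NormedSpace ℝ E]
    {s : Set E} {m : ℝ} {f g : E → ℝ} (hf : ConvexOn ℝ s f) (hg : StrongConvexOn s m g) :
    StrongConvexOn s m fun x => f x + g x := by
  refine ⟨hf.1, fun x hx y hy a b ha hb hab => ?_⟩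
  have h1 := hf.2 hx hy ha hb hab
  have h2 := hg.2 hx hy ha hb hab
  simp only [smul_eq_mul] at h1 h2 ⊢
  linarith

theorem StrongConvexOn.convexOn_of_nonneg {E : Type*} [NormedAddCommGroup E] [NormedSpace ℝ E]
    {s : Set E} {m : ℝ} {g : E → ℝ} (hm : 0 ≤ m) (hg : StrongConvexOn s m g) :
    ConvexOn ℝ s g :=
  hg.convexOn fun r => by positivity

/-! ### Smooth convex functions and Moreau envelopes. -/

/-- Convex functions with `L`-Lipschitz gradient, expressed by the two-sided (cocoercive lower,
quadratic upper) bounds on their linearization error. -/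
structure IsSmoothConvex {d : ℕ} (L : ℝ) (h : Vec d → ℝ) : Prop where
  lower : ∀ x y, h y + inner ℝ (gradient h y) (x - y)
    + 1 / (2 * L) * ‖gradient h x - gradient h y‖ ^ 2 ≤ h x
  upper : ∀ x y, h x ≤ h y + inner ℝ (gradient h y) (x - y) + L / 2 * ‖x - y‖ ^ 2

/-- The linearization error lies between `0` and a multiple of `‖x - y‖²`, hence is `o(‖x - y‖)`.
This identifies `gradient` of the envelope without differentiating the proximal map. -/
theorem hasGradientAt_of_sq_bounds {E : Type*} [NormedAddCommGroup E] [InnerProductSpace ℝ E]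
    [CompleteSpace E] {h : E → ℝ} {y v : E} {L : ℝ}
    (lower : ∀ x, h y + inner ℝ v (x - y) ≤ h x)
    (upper : ∀ x, h x ≤ h y + inner ℝ v (x - y) + L / 2 * ‖x - y‖ ^ 2) :
    HasGradientAt h v y := by
  rw [hasGradientAt_iff_isLittleO]
  have h1 : (fun x => h x - h y - inner ℝ v (x - y)) =O[𝓝 y] fun x => ‖x - y‖ ^ 2 := by
    refine Asymptotics.IsBigO.of_bound (L / 2) (Eventually.of_forall fun x => ?_)
    rw [Real.norm_eq_abs, abs_of_nonneg (by linarith [lower x]), norm_pow, norm_norm]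
    linarith [upper x]
  refine h1.trans_isLittleO ?_
  refine Asymptotics.IsLittleO.of_bound fun c hc => ?_
  filter_upwards [Metric.ball_mem_nhds y hc] with x hx
  rw [mem_ball_iff_norm] at hx
  rw [norm_pow, norm_norm, sq]
  gcongr

theorem moreauEnvelope_isLeast {d : ℕ} {δ : ℝ} {f : Vec d → ℝ} {x p : Vec d}
    (hp : ∀ y, f p + δ / 2 * ‖x - p‖ ^ 2 ≤ f y + δ / 2 * ‖x - y‖ ^ 2) :
    moreauEnvelope δ f x = f p + δ / 2 * ‖x - p‖ ^ 2 :=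
  le_antisymm (ciInf_le ⟨_, Set.forall_mem_range.2 hp⟩ p) (le_ciInf hp)

/-- The last clause says that `δ • (x - p)` is a subgradient of `f` at `p`. It is the quadratic
growth of `f + δ/2 ‖· - x‖²` around its minimizer: after expansion the terms in `‖y - p‖²` cancel.
-/
theorem exists_prox {d : ℕ} {δ : ℝ} (hδ : 0 < δ) {f : Vec d → ℝ}
    (hf : ConvexOn ℝ Set.univ f) (x : Vec d) :
    ∃ p, moreauEnvelope δ f x = f p + δ / 2 * ‖x - p‖ ^ 2 ∧
      (∀ y, moreauEnvelope δ f x ≤ f y + δ / 2 * ‖x - y‖ ^ 2) ∧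
      ∀ y, f p + inner ℝ (δ • (x - p)) (y - p) ≤ f y := by
  have hs := hf.add_strongConvexOn (strongConvexOn_sq_norm_sub δ x)
  obtain ⟨p, hp⟩ := hs.exists_forall_le hδ
  have hp' : ∀ y, f p + δ / 2 * ‖x - p‖ ^ 2 ≤ f y + δ / 2 * ‖x - y‖ ^ 2 := by
    simpa only [norm_sub_rev] using hp
  have he := moreauEnvelope_isLeast hp'
  refine ⟨p, he, fun y => he ▸ hp' y, fun y => ?_⟩
  have h1 := hs.add_sq_le_of_forall_le hp y
  have h2 : ‖y - x‖ ^ 2 = ‖y - p‖ ^ 2 - 2 * inner ℝ (x - p) (y - p) + ‖x - p‖ ^ 2 := by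
    rw [real_inner_comm, ← norm_sub_sq_real, sub_sub_sub_cancel_right]
  simp only [h2, norm_sub_rev p x] at h1
  rw [real_inner_smul_left]
  linarith

/-- The Moreau envelope of a convex function is convex with `δ`-Lipschitz gradient. -/
theorem isSmoothConvex_moreauEnvelope {d : ℕ} {δ : ℝ} (hδ : 0 < δ) {f : Vec d → ℝ}
    (hf : ConvexOn ℝ Set.univ f) : IsSmoothConvex δ (moreauEnvelope δ f) := by
  choose p hp hle hsub using exists_prox hδ hf
  -- The subgradient inequality at `p y`, tested at the point `p x`.
  have lower : ∀ x y, moreauEnvelope δ f y + inner ℝ (δ • (y - p y)) (x - y)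
      + 1 / (2 * δ) * ‖δ • (x - p x) - δ • (y - p y)‖ ^ 2 ≤ moreauEnvelope δ f x := by
    intro x y
    have h1 := hsub y (p x)
    have h2 : p x - p y = (x - y) - ((x - p x) - (y - p y)) := by abel
    rw [hp x, hp y, ← smul_sub, norm_smul, mul_pow, Real.norm_eq_abs, sq_abs]
    rw [h2] at h1
    generalize x - p x = u, y - p y = v, x - y = w at *
    rw [real_inner_smul_left, inner_sub_right, inner_sub_right, real_inner_self_eq_norm_sq]
      at h1
    have h3 : 1 / (2 * δ) * (δ ^ 2 * ‖u - v‖ ^ 2)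
        = δ / 2 * (‖u‖ ^ 2 - 2 * inner ℝ v u + ‖v‖ ^ 2) := by
      rw [real_inner_comm, norm_sub_sq_real]
      field_simp
    rw [h3, real_inner_smul_left]
    linarith
  -- Here `p y` is used as a competitor in the infimum that defines the envelope at `x`.
  have upper : ∀ x y, moreauEnvelope δ f x ≤ moreauEnvelope δ f y
      + inner ℝ (δ • (y - p y)) (x - y) + δ / 2 * ‖x - y‖ ^ 2 := by
    intro x y
    have h1 := hle x (p y)
    have h2 : x - p y = (y - p y) + (x - y) := by abel
    rw [h2, norm_add_sq_real] at h1
    rw [hp y, real_inner_smul_left]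
    linarith
  have hgrad : ∀ y, gradient (moreauEnvelope δ f) y = δ • (y - p y) := fun y =>
    (hasGradientAt_of_sq_bounds (fun x => (le_add_of_nonneg_right (by positivity)).trans
      (lower x y)) (fun x => upper x y)).gradient
  exact ⟨by simpa only [hgrad] using lower, by simpa only [hgrad] using upper⟩

theorem moreauEnvelope_le {d : ℕ} {δ : ℝ} (hδ : 0 < δ) {f : Vec d → ℝ}
    (hf : ConvexOn ℝ Set.univ f) (x : Vec d) : moreauEnvelope δ f x ≤ f x := by
  obtain ⟨p, -, h, -⟩ := exists_prox hδ hf x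
  simpa using h x

/-- By completing the square, `G r - δ/2 r²` is at most `G²/(2δ)` for every `r`; take `r = ‖x - y‖`.
-/
theorem le_moreauEnvelope_add {d : ℕ} {δ G : ℝ} (hδ : 0 < δ) {f : Vec d → ℝ}
    (hG : ∀ x y, |f x - f y| ≤ G * ‖x - y‖) (x : Vec d) :
    f x ≤ moreauEnvelope δ f x + G ^ 2 / (2 * δ) := by
  rw [← sub_le_iff_le_add]
  refine le_ciInf fun y => ?_
  have h1 := (le_abs_self _).trans (hG x y)
  have h2 : G ^ 2 / (2 * δ) = G * ‖x - y‖ - δ / 2 * ‖x - y‖ ^ 2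
      + 1 / (2 * δ) * (G - δ * ‖x - y‖) ^ 2 := by
    field_simp
    ring
  have : 0 ≤ 1 / (2 * δ) * (G - δ * ‖x - y‖) ^ 2 := by positivity
  linarith

theorem IsSmoothConvex.convexOn {d : ℕ} {L : ℝ} (hL : 0 < L) {h : Vec d → ℝ}
    (hh : IsSmoothConvex L h) : ConvexOn ℝ Set.univ h := by
  refine ⟨convex_univ, fun x _ y _ a b ha hb hab => ?_⟩
  set z := a • x + b • y
  have key : ∀ w, h z + inner ℝ (gradient h z) (w - z) ≤ h w := fun w =>
    (le_add_of_nonneg_right (by positivity)).trans (hh.lower w z)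
  have h1 := mul_le_mul_of_nonneg_left (key x) ha
  have h2 := mul_le_mul_of_nonneg_left (key y) hb
  have h3 : a * inner ℝ (gradient h z) (x - z) + b * inner ℝ (gradient h z) (y - z) = 0 := by
    rw [← real_inner_smul_right, ← real_inner_smul_right, ← inner_add_right, smul_sub, smul_sub,
      sub_add_sub_comm, ← add_smul, hab, one_smul, sub_self, inner_zero_right]
  have h4 : (a + b) * h z = h z := by rw [hab, one_mul]
  simp only [smul_eq_mul]
  linarith

end StronglyConvex

/-! ### Expectations under finitely supported distributions. -/

theorem expect_eq_sum {α : Type} {p : PMF α} {s : Finset α} (hs : p.support ⊆ s) (h : α → ℝ) :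
    expect p h = ∑ a ∈ s, (p a).toReal * h a :=
  tsum_eq_sum fun a ha => by
    rw [(p.apply_eq_zero_iff a).2 fun h => ha (hs h), ENNReal.toReal_zero, zero_mul]

theorem summable_expect {α : Type} {p : PMF α} (hp : p.support.Finite) (h : α → ℝ) :
    Summable fun a => (p a).toReal * h a :=
  summable_of_hasFiniteSupport <| hp.subset fun a ha => by
    rw [PMF.mem_support_iff]
    rintro h0
    simp [h0] at ha

theorem expect_pure {α : Type} (a : α) (h : α → ℝ) : expect (PMF.pure a) h = h a := by
  rw [expect_eq_sum (s := {a}) (by simp) h]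
  simp

theorem expect_const {α : Type} {p : PMF α} (c : ℝ) : expect p (fun _ => c) = c := by
  rw [expect, tsum_mul_right, ← ENNReal.tsum_toReal_eq fun a => p.apply_ne_top a, p.tsum_coe,
    ENNReal.toReal_one, one_mul]

theorem expect_const_mul {α : Type} (p : PMF α) (c : ℝ) (h : α → ℝ) :
    expect p (fun a => c * h a) = c * expect p h := by
  simp only [expect, ← tsum_mul_left]
  exact tsum_congr fun a => by ring

theorem expect_add {α : Type} {p : PMF α} (hp : p.support.Finite) (h k : α → ℝ) :
    expect p (fun a => h a + k a) = expect p h + expect p k := by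
  simp only [expect, mul_add]
  exact (summable_expect hp h).tsum_add (summable_expect hp k)

theorem expect_mono {α : Type} {p : PMF α} (hp : p.support.Finite) {h k : α → ℝ}
    (hhk : ∀ a ∈ p.support, h a ≤ k a) : expect p h ≤ expect p k := by
  refine (summable_expect hp h).tsum_le_tsum (fun a => ?_) (summable_expect hp k)
  by_cases ha : a ∈ p.support
  · exact mul_le_mul_of_nonneg_left (hhk a ha) ENNReal.toReal_nonneg
  · simp [(p.apply_eq_zero_iff a).2 ha]

theorem expect_uniformOfFintype {α : Type} [Fintype α] [Nonempty α] (h : α → ℝ) :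
    expect (PMF.uniformOfFintype α) h = (1 / (Fintype.card α : ℝ)) * ∑ a, h a := by
  rw [expect_eq_sum (s := Finset.univ) (by simp), Finset.mul_sum]
  simp

theorem finite_support_bind {α β : Type} {p : PMF α} {q : α → PMF β} (hp : p.support.Finite)
    (hq : ∀ a ∈ p.support, (q a).support.Finite) : (p.bind q).support.Finite := by
  rw [PMF.support_bind]
  exact hp.biUnion hq

theorem expect_bind {α β : Type} {p : PMF α} {q : α → PMF β} (hp : p.support.Finite)
    (hq : ∀ a ∈ p.support, (q a).support.Finite) (h : β → ℝ) :
    expect (p.bind q) h = expect p fun a => expect (q a) h := by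
  have hpq := finite_support_bind hp hq
  have hsub : ∀ a ∈ p.support, (q a).support ⊆ hpq.toFinset := fun a ha b hb => by
    simpa using ⟨a, (p.mem_support_iff a).1 ha, ((q a).mem_support_iff b).1 hb⟩
  have h1 : ∀ b, (p.bind q b).toReal = ∑ a ∈ hp.toFinset, (p a).toReal * (q a b).toReal := by
    intro b
    rw [PMF.bind_apply, tsum_eq_sum (s := hp.toFinset), ENNReal.toReal_sum]
    · simp
    · exact fun a _ => ENNReal.mul_ne_top (p.apply_ne_top a) ((q a).apply_ne_top b)
    · intro a ha
      rw [(p.apply_eq_zero_iff a).2 (by simpa using ha), zero_mul]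
  rw [expect_eq_sum (s := hpq.toFinset) (by simp), expect_eq_sum (s := hp.toFinset) (by simp)]
  simp only [h1, Finset.sum_mul]
  rw [Finset.sum_comm]
  refine Finset.sum_congr rfl fun a ha => ?_
  rw [expect_eq_sum (hsub a (by simpa using ha)), Finset.mul_sum]
  exact Finset.sum_congr rfl fun b _ => by ring

/-- A randomized loop whose steps have finite support, preserve an invariant and do not increase
the expectation of a potential has these properties as a whole. -/
theorem forLoop_supermartingale {σ : Type} {step : ℕ → σ → PMF σ} {Inv : ℕ → σ → Prop}
    {Φ : ℕ → σ → ℝ} {z₀ : σ} (h₀ : Inv 0 z₀)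
    (hfin : ∀ k z, Inv k z → (step k z).support.Finite)
    (hInv : ∀ k z, Inv k z → ∀ w ∈ (step k z).support, Inv (k + 1) w)
    (hΦ : ∀ k z, Inv k z → expect (step k z) (Φ (k + 1)) ≤ Φ k z) (N : ℕ) :
    (forLoop step N z₀).support.Finite ∧ (∀ w ∈ (forLoop step N z₀).support, Inv N w) ∧
      expect (forLoop step N z₀) (Φ N) ≤ Φ 0 z₀ := by
  induction N with
  | zero => exact ⟨by simp [forLoop], by simpa [forLoop] using h₀, by simp [forLoop, expect_pure]⟩
  | succ N ih =>
    obtain ⟨h1, h2, h3⟩ := ih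
    have hf := fun a ha => hfin N a (h2 a ha)
    refine ⟨finite_support_bind h1 hf, fun w hw => ?_, ?_⟩
    · obtain ⟨a, ha, hw⟩ := (PMF.mem_support_bind_iff _ _ _).1 hw
      exact hInv N a (h2 a ha) w hw
    · rw [forLoop, expect_bind h1 hf]
      exact (expect_mono h1 fun a ha => hΦ N a (h2 a ha)).trans h3

/-! ### Expected progress of one inner iteration. -/

theorem inner_average {E : Type*} [NormedAddCommGroup E] [InnerProductSpace ℝ E] {n : ℕ}
    (v : Fin n → E) (c : ℝ) (w : E) :
    inner ℝ (c • ∑ i, v i) w = c * ∑ i, inner ℝ (v i) w := by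
  rw [real_inner_smul_left, sum_inner]

/-- The variance of a uniformly sampled vector is at most its second moment. -/
theorem average_norm_sub_average_sq_le {E : Type*} [NormedAddCommGroup E] [InnerProductSpace ℝ E]
    {n : ℕ} [NeZero n] (v : Fin n → E) :
    (1 / (n : ℝ)) * ∑ i, ‖v i - (1 / (n : ℝ)) • ∑ j, v j‖ ^ 2 ≤ (1 / (n : ℝ)) * ∑ i, ‖v i‖ ^ 2 := by
  set a := (1 / (n : ℝ)) • ∑ j, v j with ha
  have hn : (n : ℝ) ≠ 0 := Nat.cast_ne_zero.2 (NeZero.ne n)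
  have h1 : (1 / (n : ℝ)) * ∑ i, inner ℝ (v i) a = ‖a‖ ^ 2 := by
    rw [← inner_average, ← ha, real_inner_self_eq_norm_sq]
  have h2 : (1 / (n : ℝ)) * ∑ _i : Fin n, ‖a‖ ^ 2 = ‖a‖ ^ 2 := by
    rw [Finset.sum_const, Finset.card_univ, Fintype.card_fin, nsmul_eq_mul]
    field_simp
  simp only [norm_sub_sq_real, Finset.sum_add_distrib, Finset.sum_sub_distrib, ← Finset.mul_sum]
  rw [mul_add, h2, mul_sub, mul_left_comm, h1]
  linarith [sq_nonneg ‖a‖]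

/-- Quadratic growth with modulus `ω/η` around the minimizer. The value of `argMin` is a minimizer
only if one exists, which strong convexity provides. -/
theorem proxStep_three_point {d : ℕ} {g : Vec d → ℝ} (hg : ConvexOn ℝ Set.univ g) {ω η : ℝ}
    (hω : 0 < ω) (hη : 0 < η) (v y z : Vec d) :
    inner ℝ v (proxStep g ω η v y - y) + ω / (2 * η) * ‖proxStep g ω η v y - y‖ ^ 2
        + g (proxStep g ω η v y) + ω / (2 * η) * ‖z - proxStep g ω η v y‖ ^ 2
      ≤ inner ℝ v (z - y) + ω / (2 * η) * ‖z - y‖ ^ 2 + g z := by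
  have hlin : ConvexOn ℝ Set.univ fun z : Vec d => inner ℝ v (z - y) + g z := by
    refine ⟨convex_univ, fun a _ b _ s t hs ht hst => ?_⟩
    have h1 := hg.2 (Set.mem_univ a) (Set.mem_univ b) hs ht hst
    have h2 : s • a + t • b - y = s • (a - y) + t • (b - y) := by
      rw [smul_sub, smul_sub, sub_add_sub_comm, ← add_smul, hst, one_smul]
    simp only [smul_eq_mul, h2, inner_add_right, real_inner_smul_right] at h1 ⊢
    linarith
  have hs := hlin.add_strongConvexOn (strongConvexOn_sq_norm_sub (ω / η) y)
  have hc : ω / η / 2 = ω / (2 * η) := by rw [div_div, mul_comm]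
  have heq : (fun z => inner ℝ v (z - y) + g z + ω / η / 2 * ‖z - y‖ ^ 2)
      = fun z => inner ℝ v (z - y) + ω / (2 * η) * ‖z - y‖ ^ 2 + g z := by
    funext z
    rw [hc]
    ring
  rw [heq] at hs
  have hmin : ∀ w, _ ≤ _ := Classical.epsilon_spec (hs.exists_forall_le (div_pos hω hη))
  have := hs.add_sq_le_of_forall_le hmin z
  rwa [hc] at this

section Step

variable {d n : ℕ} {h : Fin n → Vec d → ℝ} {g : Vec d → ℝ} {L : ℝ}

theorem svrgEstimator_uniform [NeZero n] (snap full x : Vec d) (i : Fin n) :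
    svrgEstimator h (PMF.uniformOfFintype (Fin n)) snap full x i
      = gradient (h i) x - gradient (h i) snap + full := by
  have hn : (n : ℝ) ≠ 0 := Nat.cast_ne_zero.2 (NeZero.ne n)
  simp [svrgEstimator, hn]

theorem average_lower (hh : ∀ i, IsSmoothConvex L (h i)) (x y : Vec d) :
    (1 / (n : ℝ)) * ∑ i, h i y + inner ℝ ((1 / (n : ℝ)) • ∑ i, gradient (h i) y) (x - y)
      + 1 / (2 * L) * ((1 / (n : ℝ)) * ∑ i, ‖gradient (h i) x - gradient (h i) y‖ ^ 2)
      ≤ (1 / (n : ℝ)) * ∑ i, h i x := by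
  have := mul_le_mul_of_nonneg_left (Finset.sum_le_sum fun i (_ : i ∈ Finset.univ) =>
    (hh i).lower x y) (by positivity : 0 ≤ 1 / (n : ℝ))
  simp only [Finset.sum_add_distrib, ← Finset.mul_sum] at this
  rw [inner_average]
  linarith

theorem average_upper [NeZero n] (hh : ∀ i, IsSmoothConvex L (h i)) (x y : Vec d) :
    (1 / (n : ℝ)) * ∑ i, h i x ≤
    (1 / (n : ℝ)) * ∑ i, h i y + inner ℝ ((1 / (n : ℝ)) • ∑ i, gradient (h i) y) (x - y)
      + L / 2 * ‖x - y‖ ^ 2 := by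
  have := mul_le_mul_of_nonneg_left (Finset.sum_le_sum fun i (_ : i ∈ Finset.univ) =>
    (hh i).upper x y) (by positivity : 0 ≤ 1 / (n : ℝ))
  simp only [Finset.sum_add_distrib, ← Finset.mul_sum] at this
  rw [inner_average]
  have hn : (n : ℝ) ≠ 0 := Nat.cast_ne_zero.2 (NeZero.ne n)
  have h2 : (1 / (n : ℝ)) * ∑ _i : Fin n, L / 2 * ‖x - y‖ ^ 2 = L / 2 * ‖x - y‖ ^ 2 := by
    rw [Finset.sum_const, Finset.card_univ, Fintype.card_fin, nsmul_eq_mul]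
    field_simp
  rw [← Finset.mul_sum] at h2
  linarith

/-- Expected progress of one inner iteration of ASVRG. -/
theorem innerUpdate_progress [NeZero n] (hL : 0 < L) (hh : ∀ i, IsSmoothConvex L (h i))
    (hg : ConvexOn ℝ Set.univ g) {η ω : ℝ} (hη : 0 < η) (hηL : 3 * L * η ≤ 1) (hω : 0 < ω)
    (hω2 : ω ≤ 1 / 2) (snap x y z : Vec d) (hx : x = snap + ω • (y - snap)) (y' : Fin n → Vec d)
    (hy' : ∀ i, y' i = proxStep g ω η (gradient (h i) x - gradient (h i) snap
      + (1 / (n : ℝ)) • ∑ j, gradient (h j) snap) y) :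
    (1 / (n : ℝ)) * ∑ i, (objective h g (snap + ω • (y' i - snap))
        + ω ^ 2 / (2 * η) * ‖z - y' i‖ ^ 2)
      ≤ (1 - ω) * objective h g snap + ω * objective h g z + ω ^ 2 / (2 * η) * ‖z - y‖ ^ 2 := by
  have hn : (n : ℝ) ≠ 0 := Nat.cast_ne_zero.2 (NeZero.ne n)
  set D := (1 / (n : ℝ)) • ∑ j, gradient (h j) x with hD
  set a := (1 / (n : ℝ)) • ∑ j, gradient (h j) snap with ha
  set e : Fin n → Vec d := fun i => gradient (h i) x - gradient (h i) snap with he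
  have hae : (1 / (n : ℝ)) • ∑ i, e i = D - a := by
    rw [hD, ha, ← smul_sub, ← Finset.sum_sub_distrib]
  set H : Vec d → ℝ := fun w => (1 / (n : ℝ)) * ∑ i, h i w with hH
  have hF : ∀ w, objective h g w = H w + g w := fun w => rfl
  -- deterministic bound for a fixed index
  have hdet : ∀ i, objective h g (snap + ω • (y' i - snap)) + ω ^ 2 / (2 * η) * ‖z - y' i‖ ^ 2
      ≤ H x + (1 - ω) * g snap + ω * g z + ω ^ 2 / (2 * η) * ‖z - y‖ ^ 2
        + ω * inner ℝ (e i + a) (z - y) + 1 / (4 * L) * ‖e i - (D - a)‖ ^ 2 := by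
    intro i
    have h1 := average_upper hh (snap + ω • (y' i - snap)) x
    have h2 : snap + ω • (y' i - snap) - x = ω • (y' i - y) := by
      rw [hx, add_sub_add_left_eq_sub, ← smul_sub, sub_sub_sub_cancel_right]
    have h3 := proxStep_three_point hg hω hη (e i + a) y z
    rw [← hy' i] at h3
    have h4 := hg.2 (Set.mem_univ snap) (Set.mem_univ (y' i)) (by linarith : 0 ≤ 1 - ω) hω.le
      (by ring)
    have h5 : (1 - ω) • snap + ω • y' i = snap + ω • (y' i - snap) := by
      rw [sub_smul, one_smul, smul_sub]
      abel
    have h6 := mul_le_mul_of_nonneg_left h3 hω.le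
    rw [h5] at h4
    simp only [smul_eq_mul] at h4
    rw [h2, ← hD, norm_smul, mul_pow, Real.norm_eq_abs, sq_abs, real_inner_smul_right] at h1
    rw [hF]
    -- Young's inequality
    have h7 : ω * inner ℝ D (y' i - y) ≤ ω * inner ℝ (e i + a) (y' i - y)
        + 1 / (4 * L) * ‖e i - (D - a)‖ ^ 2 + L * (ω ^ 2 * ‖y' i - y‖ ^ 2) := by
      have h8 : e i + a = D + (e i - (D - a)) := by abel
      rw [h8]
      generalize e i - (D - a) = u, y' i - y = w
      rw [inner_add_left]
      have h9 : 0 ≤ 1 / (4 * L) * ‖u + (2 * L * ω) • w‖ ^ 2 := by positivity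
      have h10 : 1 / (4 * L) * ‖u + (2 * L * ω) • w‖ ^ 2
          = 1 / (4 * L) * ‖u‖ ^ 2 + ω * inner ℝ u w + L * (ω ^ 2 * ‖w‖ ^ 2) := by
        rw [norm_add_sq_real, norm_smul, mul_pow, Real.norm_eq_abs, sq_abs, real_inner_smul_right]
        field_simp
        ring
      linarith
    -- The coefficient `3L/2` collects `L/2` from smoothness and `L` from Young's inequality; the
    -- proximal term absorbs it because `3Lη ≤ 1`.
    have h11 : 3 * L / 2 * (ω ^ 2 * ‖y' i - y‖ ^ 2) ≤ 1 / (2 * η) * (ω ^ 2 * ‖y' i - y‖ ^ 2) := by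
      refine mul_le_mul_of_nonneg_right ?_ (by positivity)
      rw [div_le_div_iff₀ two_pos (by positivity)]
      linarith
    have h12 : ω ^ 2 / (2 * η) = ω * (ω / (2 * η)) := by ring
    have h13 : 1 / (2 * η) * (ω ^ 2 * ‖y' i - y‖ ^ 2) = ω * (ω / (2 * η) * ‖y' i - y‖ ^ 2) := by
      ring
    rw [h12]
    simp only [hH]
    linarith
  -- averaging over the index
  have hvar : (1 / (n : ℝ)) * ∑ i, ‖e i - (D - a)‖ ^ 2
      ≤ 2 * L * (H snap - H x - inner ℝ D (snap - x)) := by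
    have h1 := average_norm_sub_average_sq_le e
    rw [hae] at h1
    have h2 := average_lower hh snap x
    have h3 : ∀ i, ‖gradient (h i) snap - gradient (h i) x‖ = ‖e i‖ := fun i => norm_sub_rev _ _
    simp only [h3, ← hD] at h2
    have h4 : 1 / (2 * L) * ((1 / (n : ℝ)) * ∑ i, ‖e i‖ ^ 2)
        ≤ H snap - H x - inner ℝ D (snap - x) := by
      simp only [hH]
      linarith
    rw [one_div_mul_eq_div, div_le_iff₀ (by positivity)] at h4
    linarith
  have hlow : ∀ w, H x + inner ℝ D (w - x) ≤ H w := fun w =>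
    (le_add_of_nonneg_right (by positivity)).trans (average_lower hh w x)
  have hmean : (1 / (n : ℝ)) * ∑ i, inner ℝ (e i + a) (z - y) = inner ℝ D (z - y) := by
    rw [← inner_average, Finset.sum_add_distrib, smul_add, hae, Finset.sum_const,
      Finset.card_univ, Fintype.card_fin, ← Nat.cast_smul_eq_nsmul ℝ, smul_smul,
      one_div_mul_cancel hn, one_smul, sub_add_cancel]
  have hsum := mul_le_mul_of_nonneg_left (Finset.sum_le_sum fun i (_ : i ∈ Finset.univ) =>
    hdet i) (by positivity : 0 ≤ 1 / (n : ℝ))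
  set K := H x + (1 - ω) * g snap + ω * g z + ω ^ 2 / (2 * η) * ‖z - y‖ ^ 2 with hK
  have hconst : (1 / (n : ℝ)) * ∑ i, (K + ω * inner ℝ (e i + a) (z - y)
      + 1 / (4 * L) * ‖e i - (D - a)‖ ^ 2)
      = K + ω * inner ℝ D (z - y) + 1 / (4 * L) * ((1 / (n : ℝ)) * ∑ i, ‖e i - (D - a)‖ ^ 2) := by
    rw [← hmean]
    simp only [Finset.sum_add_distrib, ← Finset.mul_sum, Finset.sum_const, Finset.card_univ,
      Fintype.card_fin, nsmul_eq_mul]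
    field_simp
  rw [hconst] at hsum
  have hgap := sub_nonneg.2 (hlow snap)
  -- The factor is `2L/(4L) = 1/2`, and `1/2 ≤ 1 - ω`. With this weight the term combines with `hin`
  -- to replace `(1 - ω) H x` by `(1 - ω) H snap`.
  have hvar' : 1 / (4 * L) * ((1 / (n : ℝ)) * ∑ i, ‖e i - (D - a)‖ ^ 2)
      ≤ (1 - ω) * (H snap - H x - inner ℝ D (snap - x)) := by
    rw [one_div_mul_eq_div, div_le_iff₀ (by positivity)]
    refine hvar.trans ?_
    have := mul_nonneg (mul_nonneg (sub_nonneg.2 hω2) hL.le) hgap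
    linarith
  -- The coupling `x = snap + ω • (y - snap)` makes `ω (z - y) = ω (z - x) + (1 - ω) (snap - x)`.
  have hin : ω * inner ℝ D (z - y)
      = ω * inner ℝ D (z - x) + (1 - ω) * inner ℝ D (snap - x) := by
    rw [← real_inner_smul_right, ← real_inner_smul_right, ← real_inner_smul_right,
      ← inner_add_right]
    congr 1
    rw [hx]
    module
  have hz := mul_le_mul_of_nonneg_left (hlow z) hω.le
  rw [hF, hF]
  linarith

end Step

/-! ### Convergence of epochs, rounds and ASVRG. -/

/-- Jensen's inequality, one summand at a time. It lets the potentials use `k * φ (sum / k)` in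
place of the sum of the values of `φ`, which the state does not record. -/
theorem ConvexOn.perspective_add_le {E : Type*} [AddCommGroup E] [Module ℝ E] {φ : E → ℝ}
    (hφ : ConvexOn ℝ Set.univ φ) (k : ℕ) (s x : E) (hs : k = 0 → s = 0) :
    ((k + 1 : ℕ) : ℝ) * φ ((1 / ((k + 1 : ℕ) : ℝ)) • (s + x))
      ≤ k * φ ((1 / (k : ℝ)) • s) + φ x := by
  have hk1 : (0 : ℝ) < (k : ℝ) + 1 := by positivity
  rcases Nat.eq_zero_or_pos k with rfl | hk
  · simp [hs rfl]
  · have hk0 : (0 : ℝ) < k := Nat.cast_pos.2 hk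
    have h1 := hφ.2 (Set.mem_univ ((1 / (k : ℝ)) • s)) (Set.mem_univ x)
      (by positivity : 0 ≤ (k : ℝ) / (k + 1)) (by positivity : 0 ≤ 1 / ((k : ℝ) + 1))
      (by field_simp)
    have h2 : ((k : ℝ) / (k + 1)) • (1 / (k : ℝ)) • s + (1 / ((k : ℝ) + 1)) • x
        = (1 / ((k : ℝ) + 1)) • (s + x) := by
      rw [smul_smul, smul_add]
      congr 2
      field_simp
    rw [h2] at h1
    push_cast
    refine (mul_le_mul_of_nonneg_left h1 hk1.le).trans (le_of_eq ?_)
    simp only [smul_eq_mul]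
    field_simp

theorem convexOn_average {d n : ℕ} {h : Fin n → Vec d → ℝ}
    (hh : ∀ i, ConvexOn ℝ Set.univ (h i)) :
    ConvexOn ℝ Set.univ fun x => (1 / (n : ℝ)) * ∑ i, h i x := by
  refine ConvexOn.smul (by positivity) ⟨convex_univ, fun x _ y _ a b ha hb hab => ?_⟩
  rw [smul_eq_mul, smul_eq_mul, Finset.mul_sum, Finset.mul_sum, ← Finset.sum_add_distrib]
  exact Finset.sum_le_sum fun i _ => (hh i).2 (Set.mem_univ x) (Set.mem_univ y) ha hb hab

theorem strongConvexOn_objective {d n : ℕ} {h : Fin n → Vec d → ℝ} {g : Vec d → ℝ} {μ : ℝ}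
    (hh : ∀ i, ConvexOn ℝ Set.univ (h i)) (hg : StrongConvexOn Set.univ μ g) :
    StrongConvexOn Set.univ μ (objective h g) :=
  (convexOn_average hh).add_strongConvexOn hg

/-- Parameters for which a round of ASVRG halves the expected suboptimality. -/
structure ASVRGParams.Admissible {n : ℕ} [NeZero n] (P : ASVRGParams n) (μ L : ℝ) : Prop where
  uniform : P.p = PMF.uniformOfFintype (Fin n)
  length : ∀ s, P.epochLength s = n
  η_pos : 0 < P.η
  η_le : 3 * L * P.η ≤ 1
  ω_pos : 0 < P.ω
  ω_le : P.ω ≤ 1 / 2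
  le_S : 2 * ((1 - P.ω) / P.ω + P.ω / (P.η * n * μ)) ≤ P.S

section Convergence

variable {d n : ℕ} {h : Fin n → Vec d → ℝ} {g : Vec d → ℝ} {μ L : ℝ}
  {P : ASVRGParams n}

theorem finite_support_innerStep (snap full : Vec d) (w : InnerState d) :
    (innerStep h g P snap full w).support.Finite :=
  finite_support_bind (Set.toFinite _) fun _ _ => by simp

theorem mem_support_innerStep {snap full : Vec d} {w w' : InnerState d}
    (hw : w' ∈ (innerStep h g P snap full w).support) :
    ∃ i, w' = innerUpdate h g P snap full w i := by
  obtain ⟨i, -, hi⟩ := (PMF.mem_support_bind_iff _ _ _).1 hw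
  exact ⟨i, by simpa using hi⟩

theorem expect_innerStep [NeZero n] (hP : P.p = PMF.uniformOfFintype (Fin n)) (snap full : Vec d)
    (w : InnerState d) (Φ : InnerState d → ℝ) :
    expect (innerStep h g P snap full w) Φ
      = (1 / (n : ℝ)) * ∑ i, Φ (innerUpdate h g P snap full w i) := by
  rw [innerStep, expect_bind (Set.toFinite _) fun _ _ => by simp]
  simp only [expect_pure]
  rw [hP, expect_uniformOfFintype, Fintype.card_fin]

/-- The state between two inner iterations, `k` iterations after the beginning of an epoch. -/
structure InnerInv (ω : ℝ) (snap : Vec d) (c : ℕ) (k : ℕ) (w : InnerState d) : Prop where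
  x_eq : w.x = snap + ω • (w.y - snap)
  sum_eq : k = 0 → w.sum = 0
  calls_eq : w.calls = c + 2 * k

/-- The potential of the inner loop, relative to a minimizer `z`. -/
noncomputable def innerPotential (h : Fin n → Vec d → ℝ) (g : Vec d → ℝ) (P : ASVRGParams n)
    (z snap : Vec d) (k : ℕ) (w : InnerState d) : ℝ :=
  k * (objective h g ((1 / (k : ℝ)) • w.sum) - objective h g z)
    + P.ω ^ 2 / (2 * P.η) * ‖z - w.y‖ ^ 2 - k * ((1 - P.ω) * (objective h g snap - objective h g z))

/-- One iteration adds at most the gap of the new `x` to `k` times the gap of the average. By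
`innerUpdate_progress`, the expectation of this gain is paid for by the change of the distance term
and by `(1 - ω)` times the gap of the snapshot. -/
theorem innerLoop_bound [NeZero n] (hP : P.Admissible μ L) (hμ : 0 < μ) (hL : 0 < L)
    (hh : ∀ i, IsSmoothConvex L (h i)) (hg : StrongConvexOn Set.univ μ g) (z snap : Vec d)
    {c : ℕ} {w₀ : InnerState d} (h₀ : InnerInv P.ω snap c 0 w₀) (N : ℕ) :
    let loop := forLoop (fun _ => innerStep h g P snap
      ((1 / (n : ℝ)) • ∑ i, gradient (h i) snap)) N w₀
    loop.support.Finite ∧ (∀ w ∈ loop.support, InnerInv P.ω snap c N w) ∧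
      expect loop (innerPotential h g P z snap N) ≤ P.ω ^ 2 / (2 * P.η) * ‖z - w₀.y‖ ^ 2 := by
  have key := forLoop_supermartingale (Φ := innerPotential h g P z snap)
    (step := fun _ => innerStep h g P snap ((1 / (n : ℝ)) • ∑ i, gradient (h i) snap)) h₀
    (fun _ w _ => finite_support_innerStep _ _ w) (fun k w hw w' hw' => ?_)
    (fun k w hw => ?_) N
  · simpa [innerPotential] using key
  · obtain ⟨i, rfl⟩ := mem_support_innerStep hw'
    exact ⟨rfl, fun hk => (Nat.succ_ne_zero k hk).elim, by
      rw [innerUpdate, hw.calls_eq]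
      ring⟩
  · rw [expect_innerStep hP.uniform]
    have hn : (n : ℝ) ≠ 0 := Nat.cast_ne_zero.2 (NeZero.ne n)
    have hconv := strongConvexOn_objective (fun i => (hh i).convexOn hL) hg
    have hφ : ConvexOn ℝ Set.univ fun x => objective h g x - objective h g z :=
      (hconv.convexOn_of_nonneg hμ.le).sub (concaveOn_const _ convex_univ)
    set y' : Fin n → Vec d := fun i => proxStep g P.ω P.η (gradient (h i) w.x
      - gradient (h i) snap + (1 / (n : ℝ)) • ∑ j, gradient (h j) snap) w.y with hy'
    have hprog := innerUpdate_progress hL hh (hg.convexOn_of_nonneg hμ.le) hP.η_pos hP.η_le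
      hP.ω_pos hP.ω_le snap w.x w.y z hw.x_eq y' fun i => rfl
    have hupd : ∀ i, innerUpdate h g P snap ((1 / (n : ℝ)) • ∑ i, gradient (h i) snap) w i
        = ⟨snap + P.ω • (y' i - snap), y' i, w.sum + (snap + P.ω • (y' i - snap)),
          w.calls + 2⟩ := fun i => by
      rw [innerUpdate, hP.uniform, svrgEstimator_uniform]
    set B := k * (objective h g ((1 / (k : ℝ)) • w.sum) - objective h g z)
      - objective h g z
      - ((k + 1 : ℕ) : ℝ) * ((1 - P.ω) * (objective h g snap - objective h g z)) with hB
    have hpt : ∀ i, innerPotential h g P z snap (k + 1) (innerUpdate h g P snap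
        ((1 / (n : ℝ)) • ∑ i, gradient (h i) snap) w i)
        ≤ B + (objective h g (snap + P.ω • (y' i - snap))
          + P.ω ^ 2 / (2 * P.η) * ‖z - y' i‖ ^ 2) := fun i => by
      rw [hupd, innerPotential, hB]
      have := hφ.perspective_add_le k w.sum (snap + P.ω • (y' i - snap)) hw.sum_eq
      dsimp only at this ⊢
      linarith
    have hsum := mul_le_mul_of_nonneg_left (Finset.sum_le_sum fun i (_ : i ∈ Finset.univ) =>
      hpt i) (by positivity : 0 ≤ 1 / (n : ℝ))
    rw [Finset.sum_add_distrib, Finset.sum_const, Finset.card_univ, Fintype.card_fin,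
      nsmul_eq_mul, mul_add, ← mul_assoc, one_div_mul_cancel hn, one_mul] at hsum
    rw [innerPotential]
    rw [hB] at hsum
    push_cast at hsum ⊢
    linarith

/-- The state between two epochs, `s` epochs after the beginning of a round. -/
structure EpochInv (n : ℕ) (ω : ℝ) (c : ℕ) (s : ℕ) (w : EpochState d) : Prop where
  x_eq : w.x = w.snap + ω • (w.y - w.snap)
  sum_eq : s = 0 → w.sum = 0
  calls_eq : w.calls = c + 3 * n * s

/-- The potential of a round of epochs, relative to a minimizer `z`. -/
noncomputable def epochPotential (h : Fin n → Vec d → ℝ) (g : Vec d → ℝ) (P : ASVRGParams n)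
    (z : Vec d) (s : ℕ) (w : EpochState d) : ℝ :=
  P.ω * (s * (objective h g ((1 / (s : ℝ)) • w.sum) - objective h g z))
    + (1 - P.ω) * (objective h g w.snap - objective h g z)
    + P.ω ^ 2 / (2 * P.η) / n * ‖z - w.y‖ ^ 2

/-- Divided by `n`, `innerLoop_bound` controls the gap of the new snapshot plus a distance term by
`(1 - ω)` times the gap of the old one plus the previous distance term. Splitting the new gap into
shares `ω` and `1 - ω`, the first share accumulates and the second pays for the next epoch. Since
`y` is carried over, the distance terms telescope. -/
theorem epochs_bound [NeZero n] (hP : P.Admissible μ L) (hμ : 0 < μ) (hL : 0 < L)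
    (hh : ∀ i, IsSmoothConvex L (h i)) (hg : StrongConvexOn Set.univ μ g) (z : Vec d)
    {c : ℕ} {w₀ : EpochState d} (h₀ : EpochInv n P.ω c 0 w₀) (N : ℕ) :
    (forLoop (epoch h g P) N w₀).support.Finite ∧
    (∀ w ∈ (forLoop (epoch h g P) N w₀).support, EpochInv n P.ω c N w) ∧
      expect (forLoop (epoch h g P) N w₀) (epochPotential h g P z N)
        ≤ epochPotential h g P z 0 w₀ := by
  have hloop := fun (k : ℕ) (w : EpochState d) (hw : EpochInv n P.ω c k w) =>
    innerLoop_bound hP hμ hL hh hg z w.snap (c := w.calls + n)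
      (w₀ := ⟨w.x, w.y, 0, w.calls + n⟩) ⟨hw.x_eq, fun _ => rfl, rfl⟩ n
  have hep : ∀ s w, epoch h g P s w = (forLoop (fun _ => innerStep h g P w.snap
      ((1 / (n : ℝ)) • ∑ i, gradient (h i) w.snap)) n ⟨w.x, w.y, 0, w.calls + n⟩).bind
      fun v => PMF.pure (epochEnd P.ω n w v) := fun s w => by rw [epoch, hP.length]
  refine forLoop_supermartingale h₀ (fun k w hw => ?_) (fun k w hw w' hw' => ?_)
    (fun k w hw => ?_) N
  · rw [hep]
    exact finite_support_bind (hloop k w hw).1 fun _ _ => by simp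
  · rw [hep] at hw'
    obtain ⟨v, hv, hvw⟩ := (PMF.mem_support_bind_iff _ _ _).1 hw'
    obtain rfl : w' = epochEnd P.ω n w v := by simpa using hvw
    have hi := (hloop k w hw).2.1 v hv
    refine ⟨?_, fun hk => (Nat.succ_ne_zero k hk).elim, ?_⟩
    · simp only [epochEnd]
      module
    · simp only [epochEnd]
      rw [hi.calls_eq, hw.calls_eq]
      ring
  · obtain ⟨hfin, -, hexp⟩ := hloop k w hw
    rw [hep, expect_bind hfin fun _ _ => by simp]
    simp only [expect_pure]
    have hn : (0 : ℝ) < n := Nat.cast_pos.2 (NeZero.pos n)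
    have hconv := strongConvexOn_objective (fun i => (hh i).convexOn hL) hg
    have hφ : ConvexOn ℝ Set.univ fun x => objective h g x - objective h g z :=
      (hconv.convexOn_of_nonneg hμ.le).sub (concaveOn_const _ convex_univ)
    set B := P.ω * (k * (objective h g ((1 / (k : ℝ)) • w.sum) - objective h g z))
      + (1 - P.ω) * (objective h g w.snap - objective h g z) with hB
    have hpt : ∀ v, epochPotential h g P z (k + 1) (epochEnd P.ω n w v)
        ≤ B + 1 / (n : ℝ) * innerPotential h g P z w.snap n v := fun v => by
      have h1 := mul_le_mul_of_nonneg_left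
        (hφ.perspective_add_le k w.sum ((1 / (n : ℝ)) • v.sum) hw.sum_eq) hP.ω_pos.le
      have h2 : 1 / (n : ℝ) * innerPotential h g P z w.snap n v
          = (objective h g ((1 / (n : ℝ)) • v.sum) - objective h g z)
            + P.ω ^ 2 / (2 * P.η) / n * ‖z - v.y‖ ^ 2
            - (1 - P.ω) * (objective h g w.snap - objective h g z) := by
        rw [innerPotential]
        field_simp
      rw [h2, hB, epochPotential, epochEnd]
      dsimp only at h1 ⊢
      linarith
    refine (expect_mono hfin fun v _ => hpt v).trans ?_
    rw [expect_add hfin, expect_const, expect_const_mul, epochPotential]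
    have h3 := mul_le_mul_of_nonneg_left hexp (by positivity : 0 ≤ 1 / (n : ℝ))
    have h4 : 1 / (n : ℝ) * (P.ω ^ 2 / (2 * P.η) * ‖z - w.y‖ ^ 2)
        = P.ω ^ 2 / (2 * P.η) / n * ‖z - w.y‖ ^ 2 := by ring
    linarith

/-- A round of ASVRG halves the expected suboptimality. -/
theorem asvrgRound_bound [NeZero n] (hP : P.Admissible μ L) (hμ : 0 < μ) (hL : 0 < L)
    (hh : ∀ i, IsSmoothConvex L (h i)) (hg : StrongConvexOn Set.univ μ g) {z : Vec d}
    (hz : ∀ x, objective h g z ≤ objective h g x) (w₀ : Vec d × ℕ) :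
    (asvrgRound h g P w₀).support.Finite ∧
    (∀ w ∈ (asvrgRound h g P w₀).support, w.2 = w₀.2 + 3 * n * P.S) ∧
      expect (asvrgRound h g P w₀) (fun w => 2 * (objective h g w.1 - objective h g z))
        ≤ objective h g w₀.1 - objective h g z := by
  obtain ⟨hfin, hInv, hexp⟩ := epochs_bound hP hμ hL hh hg z (c := w₀.2)
    (w₀ := ⟨w₀.1, w₀.1, w₀.1, 0, w₀.2⟩) ⟨by simp, fun _ => rfl, rfl⟩ P.S
  refine ⟨finite_support_bind hfin fun _ _ => by simp, fun w hw => ?_, ?_⟩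
  · obtain ⟨v, hv, hvw⟩ := (PMF.mem_support_bind_iff _ _ _).1 hw
    obtain rfl : w = ((1 / (P.S : ℝ)) • v.sum, v.calls) := by simpa using hvw
    exact (hInv v hv).calls_eq
  · rw [asvrgRound, expect_bind hfin fun _ _ => by simp]
    simp only [expect_pure]
    have hn : (0 : ℝ) < n := Nat.cast_pos.2 (NeZero.pos n)
    have hω := hP.ω_pos
    have hη := hP.η_pos
    have hω1 : 0 ≤ 1 - P.ω := by linarith [hP.ω_le]
    have hgrow := (strongConvexOn_objective (fun i => (hh i).convexOn hL) hg
      ).add_sq_le_of_forall_le hz w₀.1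
    set D := objective h g w₀.1 - objective h g z with hD
    have hpos : 0 < (1 - P.ω) / P.ω + P.ω / (P.η * n * μ) := by positivity
    -- The initial potential is at most the left side times `D`: quadratic growth bounds the
    -- distance term by `ω²/(ηnμ) * D`. The final potential contains `ω S` times the gap of the
    -- output, so this choice of `S` yields the ratio `1/2`.
    have hS : (1 - P.ω) + P.ω ^ 2 / (P.η * n * μ) ≤ P.ω * P.S / 2 := by
      have := mul_le_mul_of_nonneg_left hP.le_S hω.le
      have h1 : P.ω * (2 * ((1 - P.ω) / P.ω + P.ω / (P.η * n * μ)))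
          = 2 * ((1 - P.ω) + P.ω ^ 2 / (P.η * n * μ)) := by
        field_simp
      linarith
    have hSpos : (0 : ℝ) < P.S := by linarith [hP.le_S]
    have hD0 : 0 ≤ D := sub_nonneg.2 (hz _)
    have hbound : epochPotential h g P z 0 ⟨w₀.1, w₀.1, w₀.1, 0, w₀.2⟩ ≤ P.ω * P.S / 2 * D := by
      refine le_trans ?_ (mul_le_mul_of_nonneg_right hS hD0)
      simp only [epochPotential, Nat.cast_zero, zero_mul, mul_zero, zero_add, add_mul]
      have h1 : P.ω ^ 2 / (2 * P.η) / n * ‖z - w₀.1‖ ^ 2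
          = P.ω ^ 2 / (P.η * n * μ) * (μ / 2 * ‖w₀.1 - z‖ ^ 2) := by
        rw [norm_sub_rev]
        field_simp
      rw [h1]
      gcongr
      linarith
    have hpt : ∀ v, 2 * (objective h g ((1 / (P.S : ℝ)) • v.sum) - objective h g z)
        ≤ 2 / (P.ω * P.S) * epochPotential h g P z P.S v := fun v => by
      rw [div_mul_eq_mul_div, le_div_iff₀ (by positivity), epochPotential]
      have h1 := mul_nonneg hω1 (sub_nonneg.2 (hz v.snap))
      have h2 : 0 ≤ P.ω ^ 2 / (2 * P.η) / n * ‖z - v.y‖ ^ 2 := by positivity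
      linarith
    refine (expect_mono hfin fun v _ => hpt v).trans ?_
    rw [expect_const_mul]
    refine (mul_le_mul_of_nonneg_left (hexp.trans hbound) (by positivity)).trans (le_of_eq ?_)
    field_simp

/-- Two rounds of ASVRG divide the expected suboptimality by four. -/
theorem asvrg_bound [NeZero n] (hP : P.Admissible μ L) (hR : P.R = 2) (hμ : 0 < μ) (hL : 0 < L)
    (hh : ∀ i, IsSmoothConvex L (h i)) (hg : StrongConvexOn Set.univ μ g) {z : Vec d}
    (hz : ∀ x, objective h g z ≤ objective h g x) (w₀ : Vec d × ℕ) :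
    (asvrg h g P w₀).support.Finite ∧
    (∀ w ∈ (asvrg h g P w₀).support, w.2 = w₀.2 + 6 * n * P.S) ∧
      expect (asvrg h g P w₀) (fun w => 4 * (objective h g w.1 - objective h g z))
        ≤ objective h g w₀.1 - objective h g z := by
  have hround := asvrgRound_bound hP hμ hL hh hg hz
  obtain ⟨h1, h2, h3⟩ := forLoop_supermartingale (step := fun _ => asvrgRound h g P)
    (Inv := fun k w => w.2 = w₀.2 + 3 * n * P.S * k) (z₀ := w₀)
    (Φ := fun k w => 2 ^ k * (objective h g w.1 - objective h g z)) (by simp)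
    (fun k w _ => (hround w).1)
    (fun k w hw w' hw' => by
      rw [(hround w).2.1 w' hw', hw]
      ring)
    (fun k w _ => by
      simp only [pow_succ, mul_assoc]
      rw [expect_const_mul]
      exact mul_le_mul_of_nonneg_left (hround w).2.2 (by positivity)) 2
  rw [asvrg, hR]
  refine ⟨h1, fun w hw => ?_, ?_⟩
  · rw [h2 w hw]
    ring
  · norm_num at h3
    exact h3

end Convergence

/-! ### The parameter choice and the number of epochs. -/

section Parameters

variable {n : ℕ} [NeZero n] {μ L : ℝ}

/-- In the first regime `ω` balances the two terms: the sum is `2/ω - 1`, of order `√(L/(nμ))`. In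
the second it equals `1 + 2 = 3`. -/
theorem smoothParams_cases (hμ : 0 < μ) (hL : 0 < L) :
    0 < (smoothParams n μ L).η ∧ 3 * L * (smoothParams n μ L).η ≤ 1 ∧
      0 < (smoothParams n μ L).ω ∧ (smoothParams n μ L).ω ≤ 1 / 2 ∧
      (1 - (smoothParams n μ L).ω) / (smoothParams n μ L).ω
          + (smoothParams n μ L).ω / ((smoothParams n μ L).η * n * μ)
        ≤ 3 + 7 / 2 * √(L / (n * μ)) := by
  have hn : (0 : ℝ) < n := Nat.cast_pos.2 (NeZero.pos n)
  have hr := Real.sqrt_nonneg (L / (n * μ))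
  by_cases hc : n * μ / L ≤ 3 / 4
  · simp only [smoothParams, hc, if_true]
    rw [div_le_iff₀ hL] at hc
    have hω : 0 < √(n * μ / (3 * L)) := Real.sqrt_pos.2 (by positivity)
    have hsq : √(n * μ / (3 * L)) ^ 2 = n * μ / (3 * L) := Real.sq_sqrt (by positivity)
    have hrsq : √(L / (n * μ)) ^ 2 = L / (n * μ) := Real.sq_sqrt (by positivity)
    set ω := √(n * μ / (3 * L))
    set r := √(L / (n * μ))
    -- Here `1/ω = √3 * r` and `√3 ≤ 7/4`.
    have hinv : 1 / ω ≤ 7 / 4 * r := by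
      refine (pow_le_pow_iff_left₀ (by positivity) (by positivity) two_ne_zero).1 ?_
      rw [div_pow, mul_pow, hsq, hrsq]
      have : (1 : ℝ) ^ 2 / (n * μ / (3 * L)) = 3 * (L / (n * μ)) := by field_simp
      rw [this]
      have : 0 < L / (n * μ) := by positivity
      linarith
    have h1 : (1 - ω) / ω = 1 / ω - 1 := by field_simp
    have h2 : ω / (1 / (3 * L) * n * μ) = 1 / ω := by
      rw [div_eq_div_iff (by positivity) hω.ne', ← sq, hsq]
      field_simp
    refine ⟨by positivity, by field_simp; exact le_rfl, hω, ?_, by rw [h1, h2]; linarith⟩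
    refine (pow_le_pow_iff_left₀ hω.le (by positivity) two_ne_zero).1 ?_
    rw [hsq, div_le_iff₀ (by positivity)]
    linarith
  · simp only [smoothParams, hc, if_false]
    rw [div_le_iff₀ hL] at hc
    have h2 : (1 / 2 : ℝ) / (1 / (4 * n * μ) * n * μ) = 2 := by
      field_simp
      norm_num
    refine ⟨by positivity, ?_, by norm_num, le_rfl, ?_⟩
    · rw [mul_one_div, div_le_one (by positivity)]
      linarith
    · rw [h2]
      linarith

theorem smoothParams_admissible (hμ : 0 < μ) (hL : 0 < L) :
    (smoothParams n μ L).Admissible μ L := by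
  obtain ⟨h1, h2, h3, h4, -⟩ := smoothParams_cases (n := n) hμ hL
  refine ⟨rfl, fun s => ?_, h1, h2, h3, h4, Nat.le_ceil _⟩
  induction s with
  | zero => rfl
  | succ s ih => rw [ASVRGParams.epochLength, ih]; simp [smoothParams]

theorem smoothParams_S_le (hμ : 0 < μ) (hL : 0 < L) :
    ((smoothParams n μ L).S : ℝ) ≤ 7 + 7 * √(L / (n * μ)) := by
  obtain ⟨h1, -, h3, h4, h5⟩ := smoothParams_cases (n := n) hμ hL
  have hn : (0 : ℝ) < n := Nat.cast_pos.2 (NeZero.pos n)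
  have h6 : 0 ≤ 1 - (smoothParams n μ L).ω := by linarith
  have h7 : ((smoothParams n μ L).S : ℝ) < 2 * ((1 - (smoothParams n μ L).ω)
      / (smoothParams n μ L).ω + (smoothParams n μ L).ω / ((smoothParams n μ L).η * n * μ)) + 1 :=
    Nat.ceil_lt_add_one (by positivity)
  linarith

end Parameters

/-! ### Adaptive smoothing: error and cost over the stages. -/

section Smoothing

theorem sqrt_two_pow (k : ℕ) : √2 ^ k = √(2 ^ k) := by
  induction k with
  | zero => simp
  | succ k ih => rw [pow_succ, ih, pow_succ, Real.sqrt_mul (by positivity)]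

variable {d n : ℕ} {f : Fin n → Vec d → ℝ} {g : Vec d → ℝ} {G μ : ℝ}

theorem objective_moreauEnvelope_le {δ : ℝ} (hδ : 0 < δ)
    (hf : ∀ i, ConvexOn ℝ Set.univ (f i)) (x : Vec d) :
    objective (fun i => moreauEnvelope δ (f i)) g x ≤ objective f g x := by
  unfold objective
  gcongr with i
  exact moreauEnvelope_le hδ (hf i) x

theorem objective_le_objective_moreauEnvelope_add [NeZero n] {δ : ℝ} (hδ : 0 < δ)
    (hG : ∀ i x y, |f i x - f i y| ≤ G * ‖x - y‖) (x : Vec d) :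
    objective f g x
      ≤ objective (fun i => moreauEnvelope δ (f i)) g x + G ^ 2 / (2 * δ) := by
  have hn : (n : ℝ) ≠ 0 := Nat.cast_ne_zero.2 (NeZero.ne n)
  have h := mul_le_mul_of_nonneg_left (Finset.sum_le_sum fun i (_ : i ∈ Finset.univ) =>
    le_moreauEnvelope_add hδ (hG i) x) (by positivity : 0 ≤ 1 / (n : ℝ))
  rw [Finset.sum_add_distrib, Finset.sum_const, Finset.card_univ, Fintype.card_fin,
    nsmul_eq_mul, mul_add, ← mul_assoc (1 / (n : ℝ)) (n : ℝ), one_div_mul_cancel hn, one_mul] at h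
  unfold objective
  linarith

/-- One stage of adaptive smoothing. -/
theorem smoothedStage_bound [NeZero n] (hμ : 0 < μ) {δ : ℝ} (hδ : 0 < δ)
    (hf : ∀ i, ConvexOn ℝ Set.univ (f i)) (hG : ∀ i x y, |f i x - f i y| ≤ G * ‖x - y‖)
    (hg : StrongConvexOn Set.univ μ g) {xstar : Vec d}
    (hmin : ∀ x, objective f g xstar ≤ objective f g x) (w₀ : Vec d × ℕ) :
    let stage := asvrg (fun i => moreauEnvelope δ (f i)) g (smoothParams n μ δ) w₀
    stage.support.Finite ∧
    (∀ w ∈ stage.support, w.2 = w₀.2 + 6 * n * (smoothParams n μ δ).S) ∧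
      expect stage (fun w => 4 * (objective f g w.1 - objective f g xstar))
        ≤ objective f g w₀.1 - objective f g xstar + 5 / 2 * (G ^ 2 / δ) := by
  have hh := fun i => isSmoothConvex_moreauEnvelope hδ (hf i)
  obtain ⟨z, hz⟩ := (strongConvexOn_objective (fun i => (hh i).convexOn hδ) hg).exists_forall_le hμ
  obtain ⟨h1, h2, h3⟩ := asvrg_bound (smoothParams_admissible hμ hδ) rfl hμ hδ hh hg hz w₀
  refine ⟨h1, h2, ?_⟩
  have hle := objective_moreauEnvelope_le (g := g) hδ hf
  have hge := objective_le_objective_moreauEnvelope_add (g := g) hδ hG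
  -- The smoothing error `G²/(2δ)` enters four times at the output and once through `z`, which
  -- minimizes the smoothed objective and not `F`. This gives `2 + 1/2 = 5/2`.
  refine (expect_mono h1 (k := fun w => 2 * (G ^ 2 / δ)
    + 4 * (objective (fun i => moreauEnvelope δ (f i)) g w.1
      - objective (fun i => moreauEnvelope δ (f i)) g z)) fun w _ => ?_).trans ?_
  · have h4 : 4 * (G ^ 2 / (2 * δ)) = 2 * (G ^ 2 / δ) := by ring
    linarith [hge w.1, hz xstar, hle xstar]
  · rw [expect_add h1, expect_const]
    have h4 : G ^ 2 / (2 * δ) = 1 / 2 * (G ^ 2 / δ) := by ring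
    linarith [hle w₀.1, hge z, hmin z]

theorem six_mul_smoothParams_S_le [NeZero n] {L : ℝ} (hμ : 0 < μ) (hL : 0 < L) :
    6 * (n : ℝ) * (smoothParams n μ L).S ≤ 42 * n + 42 * √(n * L / μ) := by
  have hn : (0 : ℝ) < n := Nat.cast_pos.2 (NeZero.pos n)
  have h1 := smoothParams_S_le (n := n) hμ hL
  have h2 : (n : ℝ) * √(L / (n * μ)) = √(n * L / μ) := by
    nth_rw 1 [← Real.sqrt_sq hn.le]
    rw [← Real.sqrt_mul (by positivity)]
    congr 1
    field_simp
  rw [← h2]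
  have := mul_le_mul_of_nonneg_left h1 (by positivity : 0 ≤ 6 * (n : ℝ))
  linarith

/-- Stage `k` adds `4^k * (5/2) * Δ/2^k = (5/2) Δ 2^k` to `4^k` times the expected gap, exactly the
amount by which the correction `(5/2) Δ 2^k` in the potential grows. -/
theorem adaptSmoothASVRG_bound [NeZero n] (hμ : 0 < μ) (hGpos : 0 < G) {Δ : ℝ} (hΔ : 0 < Δ)
    (hf : ∀ i, ConvexOn ℝ Set.univ (f i)) (hG : ∀ i x y, |f i x - f i y| ≤ G * ‖x - y‖)
    (hg : StrongConvexOn Set.univ μ g) {x₀ xstar : Vec d}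
    (hmin : ∀ x, objective f g xstar ≤ objective f g x)
    (hx₀ : objective f g x₀ - objective f g xstar ≤ Δ) (T : ℕ) :
    (adaptSmoothASVRG f g μ (G ^ 2 / Δ) T x₀).support.Finite ∧
    (∀ w ∈ (adaptSmoothASVRG f g μ (G ^ 2 / Δ) T x₀).support,
      (w.2 : ℝ) ≤ 42 * n * T + 105 * (√n * G / √(μ * Δ)) * √2 ^ T) ∧
    2 ^ T * (expect (adaptSmoothASVRG f g μ (G ^ 2 / Δ) T x₀) (fun w => objective f g w.1)
      - objective f g xstar) ≤ 5 / 2 * Δ := by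
  have hn : (0 : ℝ) < n := Nat.cast_pos.2 (NeZero.pos n)
  have hδ : ∀ s : ℕ, 0 < 2 ^ s * (G ^ 2 / Δ) := fun s => by positivity
  have hst := fun s => smoothedStage_bound hμ (hδ s) hf hG hg hmin
  set A := √n * G / √(μ * Δ) with hA
  have hA0 : 0 ≤ A := by positivity
  have hcost : ∀ s : ℕ, √(n * (2 ^ s * (G ^ 2 / Δ)) / μ) = A * √2 ^ s := fun s => by
    have hA' : A = √(n * G ^ 2 / (μ * Δ)) := by
      rw [Real.sqrt_div (by positivity), Real.sqrt_mul hn.le, Real.sqrt_sq hGpos.le]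
    rw [hA', sqrt_two_pow, ← Real.sqrt_mul (by positivity)]
    congr 1
    field_simp
  -- For the geometric sum of the costs, `42 ≤ 105 (√2 - 1)` is needed, that is, `√2 ≥ 7/5`.
  have hsqrt2 : (7 : ℝ) / 5 ≤ √2 := Real.le_sqrt_of_sq_le (by norm_num)
  obtain ⟨h1, h2, h3⟩ := forLoop_supermartingale (z₀ := (x₀, 0))
    (step := fun s => asvrg (fun i => moreauEnvelope (2 ^ s * (G ^ 2 / Δ)) (f i)) g
      (smoothParams n μ (2 ^ s * (G ^ 2 / Δ))))
    (Inv := fun k w => (w.2 : ℝ) ≤ 42 * n * k + 105 * A * √2 ^ k)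
    (Φ := fun k w => -(5 / 2 * Δ * 2 ^ k)
      + 4 ^ k * (objective f g w.1 - objective f g xstar))
    (by
      simp only [Nat.cast_zero, mul_zero, pow_zero, mul_one, zero_add]
      positivity)
    (fun k w _ => (hst k w).1)
    (fun k w hw w' hw' => by
      rw [(hst k w).2.1 w' hw']
      have h4 := six_mul_smoothParams_S_le (n := n) hμ (hδ k)
      rw [hcost] at h4
      have h5 := mul_nonneg (mul_nonneg hA0 (pow_nonneg (Real.sqrt_nonneg 2) k))
        (sub_nonneg.2 hsqrt2)
      push_cast
      rw [pow_succ _ k]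
      linarith)
    (fun k w _ => by
      rw [expect_add (hst k w).1, expect_const]
      simp only [pow_succ _ k, mul_assoc]
      rw [expect_const_mul]
      have h4 := mul_le_mul_of_nonneg_left (hst k w).2.2 (by positivity : (0 : ℝ) ≤ 4 ^ k)
      have h5 : (4 : ℝ) ^ k * (5 / 2 * (G ^ 2 / (2 ^ k * (G ^ 2 / Δ)))) = 5 / 2 * (Δ * 2 ^ k) := by
        have : (4 : ℝ) ^ k = 2 ^ k * 2 ^ k := by rw [← mul_pow]; norm_num
        rw [this]
        field_simp
      rw [mul_add, h5] at h4
      linarith) T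
  refine ⟨h1, h2, ?_⟩
  have h4 : expect (adaptSmoothASVRG f g μ (G ^ 2 / Δ) T x₀)
      (fun w => objective f g w.1 - objective f g xstar)
      = expect (adaptSmoothASVRG f g μ (G ^ 2 / Δ) T x₀) (fun w => objective f g w.1)
        - objective f g xstar := by
    simp only [sub_eq_add_neg]
    rw [expect_add (p := adaptSmoothASVRG f g μ (G ^ 2 / Δ) T x₀) h1, expect_const]
  rw [expect_add h1, expect_const, expect_const_mul] at h3
  rw [← h4]
  have h5 : (4 : ℝ) ^ T = 2 ^ T * 2 ^ T := by rw [← mul_pow]; norm_num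
  rw [h5, pow_zero, pow_zero, one_mul, mul_one] at h3
  refine le_of_mul_le_mul_left ?_ (by positivity : (0 : ℝ) < 2 ^ T)
  unfold adaptSmoothASVRG
  linarith

end Smoothing

/-! ### The number of stages and the final bound. -/

/-- The number of smoothing stages is logarithmic. -/
theorem two_pow_ceil_logb_bounds {Δ ε : ℝ} (hε : 0 < ε) (hΔ : 0 < Δ) :
    4 * Δ / ε ≤ 2 ^ ⌈Real.logb 2 (4 * Δ / ε)⌉₊ ∧
      (0 < ⌈Real.logb 2 (4 * Δ / ε)⌉₊ → (2 : ℝ) ^ ⌈Real.logb 2 (4 * Δ / ε)⌉₊ ≤ 8 * Δ / ε) ∧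
      (⌈Real.logb 2 (4 * Δ / ε)⌉₊ : ℝ) ≤ 5 * max 1 (Real.log (Δ / ε)) := by
  have hpos : 0 < 4 * Δ / ε := by positivity
  set l := Real.logb 2 (4 * Δ / ε) with hl
  have h1 : (2 : ℝ) ^ l = 4 * Δ / ε := Real.rpow_logb two_pos (by norm_num) hpos
  refine ⟨?_, fun h => ?_, ?_⟩
  · rw [← h1, ← Real.rpow_natCast]
    exact Real.rpow_le_rpow_of_exponent_le one_le_two (Nat.le_ceil l)
  · have h2 := Nat.ceil_lt_add_one (Nat.ceil_pos.1 h).le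
    rw [← Real.rpow_natCast]
    refine (Real.rpow_le_rpow_of_exponent_le one_le_two h2.le).trans (le_of_eq ?_)
    rw [Real.rpow_add_one two_ne_zero, h1]
    ring
  · rcases Nat.eq_zero_or_pos ⌈l⌉₊ with h | h
    · rw [h, Nat.cast_zero]
      positivity
    · have h2 := Nat.ceil_lt_add_one (Nat.ceil_pos.1 h).le
      have h3 : l = 2 + Real.log (Δ / ε) / Real.log 2 := by
        rw [hl, mul_div_assoc, Real.logb_mul four_ne_zero (by positivity)]
        congr 1
        rw [show (4 : ℝ) = 2 ^ (2 : ℝ) by norm_num]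
        exact Real.logb_rpow two_pos (by norm_num)
      -- It suffices that `log 2 ≥ 1/2`. Then the number of stages is at most `3 + 2M ≤ 5M`, with
      -- `M` the maximum.
      have h4 : Real.log (Δ / ε) / Real.log 2 ≤ 2 * max 1 (Real.log (Δ / ε)) := by
        have hlog := Real.log_two_gt_d9
        have hmax := le_max_left 1 (Real.log (Δ / ε))
        rw [div_le_iff₀ (by linarith)]
        have h6 : 0 ≤ max 1 (Real.log (Δ / ε)) * (2 * Real.log 2 - 1) :=
          mul_nonneg (by linarith) (by linarith)
        linarith [le_max_right 1 (Real.log (Δ / ε))]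
      linarith [le_max_left 1 (Real.log (Δ / ε))]

theorem mainTheorem10 :
    ∃ C : ℝ, 0 < C ∧
      ∀ (d n : ℕ) [NeZero n] (f : Fin n → Vec d → ℝ) (g : Vec d → ℝ) (G μ : ℝ)
        (x₀ xstar : Vec d) (Δ ε : ℝ),
        0 < G → 0 < μ → 0 < ε →
        (∀ i, ConvexOn ℝ Set.univ (f i)) →
        (∀ i x y, |f i x - f i y| ≤ G * ‖x - y‖) →
        StrongConvexOn Set.univ μ g →
        (∀ x, objective f g xstar ≤ objective f g x) →
        objective f g x₀ - objective f g xstar ≤ Δ →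
        let out : PMF (Vec d × ℕ) :=
          adaptSmoothASVRG f g μ (G ^ 2 / Δ) ⌈Real.logb 2 (4 * Δ / ε)⌉₊ x₀
        (Summable fun z => (out z).toReal * objective f g z.1) ∧
        expect out (fun z => objective f g z.1) - objective f g xstar ≤ ε ∧
        ∀ z ∈ out.support,
          (z.2 : ℝ) ≤
            C * (n * max 1 (Real.log (Δ / ε)) + √n * G / √(μ * ε)) := by
  -- The constant `315 = 3 * 105` comes from the geometric sum and `√2 ^ T ≤ 3 √(Δ/ε)`; the other
  -- term needs only `42 * 5 = 210`.
  refine ⟨315, by norm_num, fun d n _ f g G μ x₀ xstar Δ ε hG hμ hε hf hlip hg hmin hΔ => ?_⟩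
  have hΔ0 : 0 ≤ Δ := (sub_nonneg.2 (hmin x₀)).trans hΔ
  intro out
  have hRHS : 0 ≤ 315 * (n * max 1 (Real.log (Δ / ε)) + √n * G / √(μ * ε)) := by positivity
  -- No stage is run. This includes `Δ = 0`, where `Real.logb 2 0 = 0`; otherwise `4Δ ≤ ε`, so `x₀`
  -- is already accurate enough. The upper bound on `2 ^ T` is available only for `T > 0`.
  by_cases hT : ⌈Real.logb 2 (4 * Δ / ε)⌉₊ = 0
  · have hout : out = PMF.pure (x₀, 0) := by
      simp only [out, hT]
      rfl
    rw [hout, expect_pure]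
    refine ⟨summable_expect (by simp) _, hΔ.trans ?_, fun z hz => ?_⟩
    · rcases hΔ0.eq_or_lt with h | h
      · exact h ▸ hε.le
      · have h1 := (two_pow_ceil_logb_bounds hε h).1
        rw [hT, pow_zero, div_le_one hε] at h1
        linarith
    · obtain rfl : z = (x₀, 0) := by simpa using hz
      simpa using hRHS
  · have hΔpos : 0 < Δ := hΔ0.lt_of_ne fun h => hT (by simp [← h])
    obtain ⟨h1, h2, h3⟩ := two_pow_ceil_logb_bounds hε hΔpos
    obtain ⟨hfin, hcalls, hexp⟩ :=
      adaptSmoothASVRG_bound hμ hG hΔpos hf hlip hg hmin hΔ ⌈Real.logb 2 (4 * Δ / ε)⌉₊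
    have h2 := h2 (Nat.pos_of_ne_zero hT)
    set T := ⌈Real.logb 2 (4 * Δ / ε)⌉₊
    refine ⟨summable_expect hfin _, ?_, fun z hz => (hcalls z hz).trans ?_⟩
    -- Since `2 ^ T * ε ≥ 4Δ`, a gap above `ε` would contradict the bound `5/2 * Δ`.
    · by_contra! hlt
      have h4 := mul_lt_mul_of_pos_left (a := (2 : ℝ) ^ T) hlt (by positivity)
      have h5 := mul_le_mul_of_nonneg_right h1 hε.le
      rw [div_mul_cancel₀ _ hε.ne'] at h5
      linarith
    -- From `2 ^ T ≤ 8Δ/ε` and `√8 ≤ 3`.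
    · have h4 : √2 ^ T ≤ 3 * (√Δ / √ε) := by
        rw [sqrt_two_pow, ← Real.sqrt_div hΔpos.le]
        refine (Real.sqrt_le_sqrt h2).trans ?_
        rw [Real.sqrt_le_iff]
        refine ⟨by positivity, ?_⟩
        rw [mul_pow, Real.sq_sqrt (by positivity), mul_div_assoc]
        have : 0 < Δ / ε := by positivity
        linarith
      have h5 : √n * G / √(μ * Δ) * √2 ^ T ≤ 3 * (√n * G / √(μ * ε)) := by
        refine (mul_le_mul_of_nonneg_left h4 (by positivity)).trans (le_of_eq ?_)
        rw [Real.sqrt_mul hμ.le, Real.sqrt_mul hμ.le]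
        have := Real.sqrt_pos.2 hΔpos
        field_simp
      have h6 := mul_le_mul_of_nonneg_left h3 (by positivity : (0 : ℝ) ≤ n)
      have h7 : 0 ≤ (n : ℝ) * max 1 (Real.log (Δ / ε)) := by positivity
      linarith
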